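/- Let $X$ be a nonempty regular Hausdorff topological space. Let $\mathcal{O}$ denote the collection of all open covers of $X$, and let $\Omega$ denote the collection of all $\omega$-covers of $X$, i.e. of those open covers $\mathcal{U}$ of $X$ such that $X\notin\mathcal{U}$ and each finite subset of $X$ is contained in some member of $\mathcal{U}$. The following statements are equivalent: 1. $X$ has the Rothberger property $\mathsf{S}_1(\mathcal{O},\mathcal{O})$: for each sequence $(\mathcal{U}_n)_{n\in\mathbb{N}}$ of open covers of $X$ there is a sequence $(T_n)_{n\in\mathbb{N}}$ such that $T_n\in\mathcal{U}_n$ for each $n$ and $\{T_n:n\in\mathbb{N}\}$ is a cover of $X$. 2. ONE has no winning strategy in the game $\mathsf{G}_1(\mathcal{O},\mathcal{O})$ on $X$. In this game players ONE and TWO play an inning for each $n\in\mathbb{N}$; in the $n$-th inning ONE chooses an open cover $\mathcal{U}_n$ of $X$, and TWO responds by choosing $T_n\in\mathcal{U}_n$. TWO wins the play if $\{T_n:n\in\mathbb{N}\}$ is a cover of $X$; otherwise ONE wins. 3. For each positive integer $k$ the partition relation $\Omega\longrightarrow(\mathcal{O})^2_k$ holds: for each $\mathcal{U}\in\Omega$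 and each function $f:[\mathcal{U}]^2\to\{1,\dots,k\}$, where $[\mathcal{U}]^2$ denotes the set of two-element subsets of $\mathcal{U}$, there are $i\in\{1,\dots,k\}$ and $\mathcal{V}\subseteq\mathcal{U}$ such that $\mathcal{V}$ is a cover of $X$ and $f$ is constant of value $i$ on $[\mathcal{V}]^2$. -/

import Mathlib

namespace CoverRamsey

section General

variable {α : Type*}

/-- The selection principle `S₁(𝒜, ℬ)`: for each sequence `O 0, O 1, …` of members of `𝒜` one can
choose `T n ∈ O n` for each `n` so that the set `{T n : n}` is a member of `ℬ`. -/
def SelectOne (𝒜 ℬ : Set (Set α)) : Prop :=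
  ∀ O : ℕ → Set α, (∀ n, O n ∈ 𝒜) →
    ∃ T : ℕ → α, (∀ n, T n ∈ O n) ∧ Set.range T ∈ ℬ

/-- A strategy for player ONE in the game `G₁(𝒜, ℬ)`: to each finite sequence
`[T 0, …, T (n - 1)]` of earlier moves of TWO it assigns the next move of ONE, a member of `𝒜`. -/
structure StrategyOne (𝒜 : Set (Set α)) where
  /-- ONE's move after TWO has made the listed moves. -/
  move : List α → Set α
  /-- ONE always plays a member of `𝒜`. -/
  move_mem : ∀ s, move s ∈ 𝒜

/-- `T` is the sequence of TWO's moves in an infinite play of `G₁` in which ONE follows `F`: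
in each inning `n`, TWO picks a member of the set that `F` prescribes after
`T 0, …, T (n - 1)`. -/
def StrategyOne.IsPlay {𝒜 : Set (Set α)} (F : StrategyOne 𝒜) (T : ℕ → α) : Prop :=
  ∀ n, T n ∈ F.move (List.ofFn fun i : Fin n => T i)

/-- `F` is a winning strategy for ONE in `G₁(𝒜, ℬ)`. TWO wins a play precisely when the set of
TWO's moves is a member of `ℬ`; otherwise ONE wins it. -/
def StrategyOne.IsWinning {𝒜 : Set (Set α)} (F : StrategyOne 𝒜) (ℬ : Set (Set α)) : Prop :=
  ∀ T : ℕ → α, F.IsPlay T → Set.range T ∉ ℬ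

/-- ONE has a winning strategy in the game `G₁(𝒜, ℬ)`. -/
def OneHasWinningStrategy (𝒜 ℬ : Set (Set α)) : Prop :=
  ∃ F : StrategyOne 𝒜, F.IsWinning ℬ

/-- `[A]^m`: the set of all `m`-element subsets of `A`. -/
def subsetsOfSize (A : Set α) (m : ℕ) : Set (Finset α) :=
  {s | (s : Set α) ⊆ A ∧ s.card = m}

/-- The partition relation `𝒜 ⟶ (ℬ₁, …, ℬₖ)^m`: for each `A ∈ 𝒜` and each colouring `f` of
`[A]^m` with `k` colours there are a colour `i` and a set `B ⊆ A` with `B ∈ ℬᵢ` such that `f` is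
constant of value `i` on `[B]^m`. -/
def ArrowFamilies (𝒜 : Set (Set α)) {k : ℕ} (ℬ : Fin k → Set (Set α)) (m : ℕ) : Prop :=
  ∀ A ∈ 𝒜, ∀ f : subsetsOfSize A m → Fin k,
    ∃ i : Fin k, ∃ B : Set α, B ⊆ A ∧ B ∈ ℬ i ∧
      ∀ s : subsetsOfSize A m, (s : Finset α) ∈ subsetsOfSize B m → f s = i

/-- The partition relation `𝒜 ⟶ (ℬ)^m_k`. -/
def Arrow (𝒜 ℬ : Set (Set α)) (m k : ℕ) : Prop :=
  ArrowFamilies 𝒜 (fun _ : Fin k => ℬ) m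

end General

section Covers

/-- `𝒪`: the collection of all open covers of the space `X`. -/
def openCovers (X : Type*) [TopologicalSpace X] : Set (Set (Set X)) :=
  {𝒰 | (∀ U ∈ 𝒰, IsOpen U) ∧ ⋃₀ 𝒰 = Set.univ}

/-- `Ω`: the collection of all `ω`-covers of `X`, that is, of the open covers `𝒰` such that `X` is
not a member of `𝒰` but each finite subset of `X` is contained in some member of `𝒰`. -/
def omegaCovers (X : Type*) [TopologicalSpace X] : Set (Set (Set X)) :=
  {𝒰 | 𝒰 ∈ openCovers X ∧ Set.univ ∉ 𝒰 ∧
    ∀ F : Set X, F.Finite → ∃ U ∈ 𝒰, F ⊆ U}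

/-- The Rothberger covering property `S₁(𝒪, 𝒪)`. -/
def IsRothberger (X : Type*) [TopologicalSpace X] : Prop :=
  SelectOne (openCovers X) (openCovers X)

end Covers

end CoverRamsey

namespace CoverRamsey

open Set Filter

/-! ### From the game to the partition relation, by an ultrafilter. -/

section Ramsey

variable {X : Type*} [TopologicalSpace X]

/-! The cycle is 1 → 2 → 3 → 1. Pawlikowski's theorem gives 1 → 2: ONE's moves are thinned to
countable covers and TWO's answers are bounded by a function `f`, so that each inning has finitely
many positions. The Rothberger property first finds `f` (`exists_frequently_mem_levelSet`), then one
answer per position (`exists_answers`). For 2 → 3, an ultrafilter on the `ω`-cover turns the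
colouring into a strategy for ONE whose lost plays list homogeneous covers. For 3 → 1, a
two-colouring by index shows that a homogeneous cover is a selection from a sequence of `ω`-covers;
finite unions then reduce open covers to `ω`-covers. -/

/-- An `ω`-cover carries an ultrafilter all of whose members contain `ω`-covers. -/
theorem exists_ultrafilter_of_mem_omegaCovers {A : Set (Set X)} (hA : A ∈ omegaCovers X) :
    ∃ p : Ultrafilter (Set X), (∀ᶠ V in p, V ∈ A) ∧ ∀ x, ∀ᶠ V : Set X in p, x ∈ V := by
  classical
  obtain ⟨-, -, hfin⟩ := hA
  let B : Finset X → Filter (Set X) := fun E => 𝓟 {V | V ∈ A ∧ (E : Set X) ⊆ V}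
  have hB : (⨅ E, B E).NeBot := by
    refine iInf_neBot_of_directed' ?_ fun E => ?_
    · intro E E'
      refine ⟨E ∪ E', ?_, ?_⟩ <;>
      · refine principal_mono.2 fun V hV => ⟨hV.1, ?_⟩
        have := hV.2
        simp only [Finset.coe_union, union_subset_iff] at this
        tauto
    · obtain ⟨V, hV, hEV⟩ := hfin E E.finite_toSet
      exact principal_neBot_iff.2 ⟨V, hV, hEV⟩
  have hle (E : Finset X) : ∀ᶠ V in Ultrafilter.of (⨅ E, B E), V ∈ A ∧ (E : Set X) ⊆ V :=
    Ultrafilter.of_le _ (mem_iInf_of_mem E (mem_principal_self _))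
  refine ⟨Ultrafilter.of (⨅ E, B E), (hle ∅).mono fun V h => h.1, fun x => ?_⟩
  exact (hle {x}).mono fun V h => h.2 (by simp)

theorem exists_eventually_eq_of_finite {α β : Type*} [Finite β] (p : Ultrafilter α) (g : α → β) :
    ∃ b, ∀ᶠ a in p, g a = b := by
  obtain ⟨b, hb⟩ := Ultrafilter.eq_pure_of_finite (p.map g)
  refine ⟨b, ?_⟩
  have : {b} ∈ p.map g := by rw [hb]; exact mem_pure.2 rfl
  exact this

/-- Each `U` has a limit colour `c U` along the ultrafilter, and `c` has a limit `i`. The sets of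
limit colour `i` joined in colour `i` to all earlier answers are ultrafilter-many, hence a legal
move for ONE. -/
theorem arrow_of_not_oneHasWinningStrategy
    (h : ¬ OneHasWinningStrategy (openCovers X) (openCovers X)) {k : ℕ} (hk : 0 < k) :
    Arrow (omegaCovers X) (openCovers X) 2 k := by
  classical
  intro A hA f
  obtain ⟨p, hpA, hpx⟩ := exists_ultrafilter_of_mem_omegaCovers hA
  -- The default colour, which needs `0 < k`, is harmless: only pairs of distinct members of `A`
  -- matter later.
  let g : Set X → Set X → Fin k := fun U V =>
    if h : ({U, V} : Finset (Set X)) ∈ subsetsOfSize A 2 then f ⟨_, h⟩ else ⟨0, hk⟩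
  choose c hc using fun U => exists_eventually_eq_of_finite p (g U)
  obtain ⟨i, hi⟩ := exists_eventually_eq_of_finite p c
  have hne {W : Set X} (hW : W ∈ A) : ∀ᶠ U in p, U ≠ W := by
    obtain ⟨x, hx⟩ := (ne_univ_iff_exists_notMem W).1 fun h => hA.2.1 (h ▸ hW)
    exact (hpx x).mono fun U hU hUW => hx (hUW ▸ hU)
  let move : List (Set X) → Set (Set X) := fun s =>
    {U | U ∈ A ∧ c U = i ∧ ∀ W ∈ s, W ∈ A → c W = i → U ≠ W ∧ g W U = i}
  have hmove (s) : ∀ᶠ U in p, U ∈ move s := by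
    refine hpA.and (hi.and ?_)
    have : ∀ᶠ U in p, ∀ W ∈ s.toFinset, W ∈ A → c W = i → U ≠ W ∧ g W U = i := by
      refine (Finset.eventually_all _).2 fun W _ => ?_
      by_cases hW : W ∈ A ∧ c W = i
      · filter_upwards [hne hW.1, hc W] with U h1 h2 _ _ using ⟨h1, h2.trans hW.2⟩
      · exact Eventually.of_forall fun U h1 h2 => (hW ⟨h1, h2⟩).elim
    simpa using this
  let F : StrategyOne (openCovers X) :=
    { move := move
      move_mem := fun s => by
        refine ⟨fun U hU => hA.1.1 U hU.1, eq_univ_of_forall fun x => ?_⟩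
        obtain ⟨U, hU, hx⟩ := ((hmove s).and (hpx x)).exists
        exact ⟨U, hU, hx⟩ }
  have hF : ¬ F.IsWinning (openCovers X) := fun hF => h ⟨F, hF⟩
  simp only [StrategyOne.IsWinning, not_forall, not_not] at hF
  obtain ⟨T, hT, hTc⟩ := hF
  have hTA (n) : T n ∈ A ∧ c (T n) = i := ⟨(hT n).1, (hT n).2.1⟩
  have hlt {m n : ℕ} (hmn : m < n) : T n ≠ T m ∧ g (T m) (T n) = i :=
    (hT n).2.2 (T m) (List.mem_ofFn.2 ⟨⟨m, hmn⟩, rfl⟩) (hTA m).1 (hTA m).2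
  refine ⟨i, range T, by rintro _ ⟨n, rfl⟩; exact (hTA n).1, hTc, ?_⟩
  have key {m n : ℕ} (hmn : m < n) (s : subsetsOfSize A 2) (hs : (s : Finset (Set X)) = {T m, T n}) :
      f s = i := by
    have hs' : ({T m, T n} : Finset (Set X)) ∈ subsetsOfSize A 2 := hs ▸ s.2
    have := (hlt hmn).2
    simp only [g, dif_pos hs'] at this
    rw [← this]
    congr 1
    exact Subtype.ext hs
  intro s hs
  obtain ⟨hsub, hcard⟩ := hs
  obtain ⟨U, V, hUV, hsUV⟩ := Finset.card_eq_two.1 hcard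
  rw [hsUV] at hsub
  obtain ⟨m, rfl⟩ := hsub (show U ∈ _ by simp)
  obtain ⟨n, rfl⟩ := hsub (show V ∈ _ by simp)
  rcases lt_trichotomy m n with hmn | rfl | hmn
  · exact key hmn s hsUV
  · exact (hUV rfl).elim
  · exact key hmn s (hsUV.trans (Finset.pair_comm _ _))

end Ramsey

/-! ### From the partition relation back to the Rothberger property. -/

section Selection

variable {X : Type*} [TopologicalSpace X]

theorem isRothberger_of_finite [Finite X] [Nonempty X] : IsRothberger X := by
  intro O hO
  have hx (n : ℕ) (x : X) : ∃ U ∈ O n, x ∈ U := by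
    have : x ∈ ⋃₀ O n := (hO n).2 ▸ mem_univ x
    exact this
  obtain ⟨e, he⟩ := exists_surjective_nat X
  choose T hT hxT using fun n => hx n (e n)
  refine ⟨T, hT, by rintro _ ⟨n, rfl⟩; exact (hO n).1 _ (hT n), eq_univ_of_forall fun x => ?_⟩
  obtain ⟨n, rfl⟩ := he x
  exact ⟨T n, ⟨n, rfl⟩, hxT n⟩

/-- Every infinite `T₁` space has a countable `ω`-cover, so that a sequence of `ω`-covers can be
joined into a single one. -/
theorem selectOne_omegaCovers_of_arrow [T1Space X] [Infinite X]
    (h : Arrow (omegaCovers X) (openCovers X) 2 2) :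
    SelectOne (omegaCovers X) (openCovers X) := by
  classical
  intro O hO
  let x : ℕ → X := Infinite.natEmbedding X
  have hx : Function.Injective x := (Infinite.natEmbedding X).injective
  -- Deleting `x n` marks the sets coming from `O n`: those of a single index cannot cover `X`.
  let A : Set (Set X) := {W | ∃ n, ∃ V ∈ O n, W = {x n}ᶜ ∩ V}
  have hAo : ∀ U ∈ A, IsOpen U := by
    rintro _ ⟨n, V, hV, rfl⟩
    exact isOpen_compl_singleton.inter ((hO n).1.1 V hV)
  have hAω : ∀ F : Set X, F.Finite → ∃ U ∈ A, F ⊆ U := by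
    intro F hF
    obtain ⟨_, ⟨n, rfl⟩, hn⟩ := (infinite_range_of_injective hx).exists_notMem_finite hF
    obtain ⟨V, hV, hFV⟩ := (hO n).2.2 F hF
    exact ⟨_, ⟨n, V, hV, rfl⟩, subset_inter (subset_compl_singleton_iff.2 hn) hFV⟩
  have hA : A ∈ omegaCovers X := by
    refine ⟨⟨hAo, eq_univ_of_forall fun y => ?_⟩, ?_, hAω⟩
    · obtain ⟨U, hU, hy⟩ := hAω {y} (finite_singleton y)
      exact ⟨U, hU, hy rfl⟩
    · rintro ⟨n, V, -, hV⟩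
      have : x n ∈ {x n}ᶜ ∩ V := hV ▸ mem_univ _
      exact this.1 rfl
  have hidx : ∀ W : Set X, ∃ n, W ∈ A → ∃ V ∈ O n, W = {x n}ᶜ ∩ V := by
    intro W
    by_cases hW : W ∈ A
    · obtain ⟨n, hn⟩ := hW
      exact ⟨n, fun _ => hn⟩
    · exact ⟨0, fun h => (hW h).elim⟩
  choose ν hν using hidx
  let f : subsetsOfSize A 2 → Fin 2 := fun s =>
    if ∃ U ∈ (s : Finset (Set X)), ∃ V ∈ (s : Finset (Set X)), ν U ≠ ν V then 1 else 0
  obtain ⟨i, B, hBA, hB, hBf⟩ := h A hA f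
  have hpair {U V : Set X} (hU : U ∈ B) (hV : V ∈ B) (hUV : U ≠ V) :
      i = 1 ↔ ν U ≠ ν V := by
    have hmem {C : Set (Set X)} (h1 : U ∈ C) (h2 : V ∈ C) :
        ({U, V} : Finset (Set X)) ∈ subsetsOfSize C 2 :=
      ⟨by simp [insert_subset_iff, h1, h2], Finset.card_pair hUV⟩
    rw [← hBf ⟨_, hmem (hBA hU) (hBA hV)⟩ (hmem hU hV)]
    simp only [f]
    split_ifs with h1
    · simp only [true_iff]
      simp only [Finset.mem_insert, Finset.mem_singleton] at h1
      obtain ⟨_, rfl | rfl, _, rfl | rfl, h⟩ := h1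
      · exact (h rfl).elim
      · exact h
      · exact h.symm
      · exact (h rfl).elim
    · refine iff_of_false (by simp) fun h => h1 ⟨U, by simp, V, by simp, h⟩
  have hcov (y : X) : ∃ U ∈ B, y ∈ U := by
    have : y ∈ ⋃₀ B := hB.2 ▸ mem_univ y
    exact this
  -- In the other colour all of `B` would share one index `n`, and `x n` would be uncovered.
  have hi : i = 1 := by
    by_contra hi
    obtain ⟨U, hU, -⟩ := hcov (x 0)
    obtain ⟨V, hV, hxV⟩ := hcov (x (ν U))
    have hUV : ν U = ν V := by
      by_cases hUV : U = V
      · rw [hUV]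
      · by_contra hne
        exact hi ((hpair hU hV hUV).2 hne)
    obtain ⟨V', -, hV'⟩ := hν V (hBA hV)
    rw [hV', hUV] at hxV
    exact hxV.1 rfl
  have hinj : InjOn ν B := fun U hU V hV hUV => by
    by_contra hne
    exact (hpair hU hV hne).1 hi hUV
  have hT (n) : ∃ V ∈ O n, ∀ W ∈ B, ν W = n → W ⊆ V := by
    by_cases hn : ∃ W ∈ B, ν W = n
    · obtain ⟨W, hW, rfl⟩ := hn
      obtain ⟨V, hV, hWV⟩ := hν W (hBA hW)
      refine ⟨V, hV, fun W' hW' h => ?_⟩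
      rw [hinj hW' hW h, hWV]
      exact inter_subset_right
    · obtain ⟨V, hV, -⟩ := (hO n).2.2 ∅ finite_empty
      exact ⟨V, hV, fun W hW h => (hn ⟨W, hW, h⟩).elim⟩
  choose T hTO hTB using hT
  refine ⟨T, hTO, by rintro _ ⟨n, rfl⟩; exact (hO n).1.1 _ (hTO n), eq_univ_of_forall fun y => ?_⟩
  obtain ⟨U, hU, hy⟩ := hcov y
  exact ⟨_, ⟨ν U, rfl⟩, hTB _ U hU rfl hy⟩

/-- The covers are split by `Nat.pair` into infinitely many infinite blocks. Finite unions of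
selections along one block form an `ω`-cover, unless one of them is `X`; then that block alone
suffices. -/
theorem isRothberger_of_selectOne_omegaCovers [Nonempty X]
    (h : SelectOne (omegaCovers X) (openCovers X)) : IsRothberger X := by
  classical
  intro O hO
  have hx (n : ℕ) (x : X) : ∃ U ∈ O n, x ∈ U := by
    have : x ∈ ⋃₀ O n := (hO n).2 ▸ mem_univ x
    exact this
  choose g hgO hxg using hx
  suffices ∃ c : ℕ → ℕ → Set X, (∀ n m, c n m ∈ O (Nat.pair n m)) ∧ ∀ x, ∃ n m, x ∈ c n m by
    obtain ⟨c, hc, hcx⟩ := this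
    have hT (j : ℕ) : c j.unpair.1 j.unpair.2 ∈ O j := by
      simpa using hc j.unpair.1 j.unpair.2
    refine ⟨fun j => c j.unpair.1 j.unpair.2, hT, by rintro _ ⟨n, rfl⟩; exact (hO n).1 _ (hT n),
      eq_univ_of_forall fun x => ?_⟩
    obtain ⟨n, m, hxc⟩ := hcx x
    exact ⟨_, ⟨Nat.pair n m, rfl⟩, by simpa using hxc⟩
  let A : ℕ → Set (Set X) := fun n =>
    {W | ∃ S : Finset ℕ, ∃ c : ℕ → Set X, (∀ m, c m ∈ O (Nat.pair n m)) ∧ W = ⋃ m ∈ S, c m}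
  have hAω (n) (F : Set X) (hF : F.Finite) : ∃ U ∈ A n, F ⊆ U := by
    obtain ⟨φ, hφ⟩ := countable_iff_exists_injOn.1 hF.countable
    -- The point `x` of `F` is covered from the cover number `φ x` of the block.
    refine ⟨_, ⟨(hF.image φ).toFinset, fun m => g _ (Function.invFunOn φ F m),
      fun m => hgO _ _, rfl⟩, fun x hxF => ?_⟩
    refine mem_biUnion (x := φ x) (by simpa using ⟨x, hxF, rfl⟩) ?_
    have : Function.invFunOn φ F (φ x) = x := hφ.leftInvOn_invFunOn hxF
    simpa only [this] using hxg (Nat.pair n (φ x)) x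
  by_cases huniv : ∃ n, univ ∈ A n
  · obtain ⟨n, S, c, hc, hS⟩ := huniv
    refine ⟨Function.update (fun n m => g (Nat.pair n m) (Classical.arbitrary X)) n c,
      fun n' m => ?_, fun x => ?_⟩
    · by_cases hn : n' = n
      · subst hn; simpa using hc m
      · simpa [hn] using hgO _ _
    · have : x ∈ ⋃ m ∈ S, c m := hS ▸ mem_univ x
      obtain ⟨m, -, hm⟩ := mem_iUnion₂.1 this
      exact ⟨n, m, by simpa using hm⟩
  · obtain ⟨T, hT, hTc⟩ := h A fun n => by
      refine ⟨⟨?_, eq_univ_of_forall fun x => ?_⟩, fun h => huniv ⟨n, h⟩, hAω n⟩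
      · rintro _ ⟨S, c, hc, rfl⟩
        exact isOpen_biUnion fun m _ => (hO _).1 _ (hc m)
      · obtain ⟨U, hU, hxU⟩ := hAω n {x} (finite_singleton x)
        exact ⟨U, hU, hxU rfl⟩
    choose S c hc hS using hT
    refine ⟨c, hc, fun x => ?_⟩
    obtain ⟨_, ⟨n, rfl⟩, hxn⟩ : x ∈ ⋃₀ range T := hTc.2 ▸ mem_univ x
    rw [hS] at hxn
    obtain ⟨m, -, hm⟩ := mem_iUnion₂.1 hxn
    exact ⟨n, m, hm⟩

end Selection

/-! ### Pawlikowski's theorem: from the Rothberger property to the game. -/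

section Game

variable {X : Type*}

/-- The positions of length `n` in which TWO has answered each inning `i` with one of the sets
`e s 0, …, e s (h i)`, where `s` is the position before that inning. -/
def reach (e : List (Set X) → ℕ → Set X) (h : ℕ → ℕ) : ℕ → Set (List (Set X))
  | 0 => {[]}
  | n + 1 => ⋃ s ∈ reach e h n, (fun m => s ++ [e s m]) '' Iic (h n)

theorem finite_reach (e : List (Set X) → ℕ → Set X) (h : ℕ → ℕ) (n : ℕ) :
    (reach e h n).Finite := by
  induction n with
  | zero => exact finite_singleton _
  | succ n ih => exact ih.biUnion fun s _ => (finite_Iic _).image _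

theorem reach_mono (e : List (Set X) → ℕ → Set X) {h h' : ℕ → ℕ} {n : ℕ}
    (hh : ∀ i < n, h i ≤ h' i) : reach e h n ⊆ reach e h' n := by
  induction n with
  | zero => exact subset_rfl
  | succ n ih =>
    refine biUnion_mono (ih fun i hi => hh i (hi.trans n.lt_succ_self)) fun s _ => ?_
    exact image_mono (Iic_subset_Iic.2 (hh n n.lt_succ_self))

/-- The points covered at inning `n` whatever position of `reach e h n` has been reached. -/
def levelSet (e : List (Set X) → ℕ → Set X) (h : ℕ → ℕ) (n : ℕ) : Set X :=
  ⋂ s ∈ reach e h n, ⋃ m ∈ Iic (h n), e s m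

/-- The sequence that satisfies `f n = Φ n (f 0, …, f (n - 1), 0, 0, …)`. -/
def courseOfValues (Φ : ℕ → (ℕ → ℕ) → ℕ) (n : ℕ) : ℕ :=
  Φ n fun i => if _h : i < n then courseOfValues Φ i else 0

/-- Every bound on the first `N` innings extends to a bound that makes all later levels contain a
given point. -/
theorem exists_extension_mem_levelSet {e : List (Set X) → ℕ → Set X}
    (he : ∀ s x, ∃ m, x ∈ e s m) (p : ℕ → ℕ) (N : ℕ) (x : X) :
    ∃ h : ℕ → ℕ, (∀ i < N, h i = p i) ∧ ∀ i, N ≤ i → x ∈ levelSet e h i := by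
  classical
  have hbound (h : ℕ → ℕ) (n : ℕ) : ∃ b, ∀ s ∈ reach e h n, ∃ m ≤ b, x ∈ e s m := by
    choose φ hφ using fun s => he s x
    obtain ⟨b, hb⟩ := ((finite_reach e h n).image φ).bddAbove
    exact ⟨b, fun s hs => ⟨φ s, hb ⟨s, hs, rfl⟩, hφ s⟩⟩
  choose b hb using hbound
  -- Past `N`, the value at `n` is a bound for the finitely many positions that the earlier values
  -- allow.
  let Φ : ℕ → (ℕ → ℕ) → ℕ := fun n h => if n < N then p n else b h n
  refine ⟨courseOfValues Φ, fun i hi => ?_, fun i hi => ?_⟩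
  · rw [courseOfValues]; simp [Φ, hi]
  · simp only [levelSet, mem_iInter₂, mem_iUnion₂]
    intro s hs
    have hs' := reach_mono e (h' := fun j => if _h : j < i then courseOfValues Φ j else 0)
      (fun j hj => by simp [hj]) hs
    obtain ⟨m, hm, hxm⟩ := hb _ _ s hs'
    refine ⟨m, ?_, hxm⟩
    rw [courseOfValues]
    simpa [Φ, not_lt.2 hi] using hm

variable [TopologicalSpace X]

theorem isOpen_levelSet {e : List (Set X) → ℕ → Set X} (heo : ∀ s m, IsOpen (e s m))
    (h : ℕ → ℕ) (n : ℕ) : IsOpen (levelSet e h n) :=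
  (finite_reach e h n).isOpen_biInter fun s _ => isOpen_biUnion fun m _ => heo s m

/-- In a Rothberger space some bound on TWO's moves makes each point covered in infinitely many
innings, whatever bounded position has been reached. -/
theorem IsRothberger.exists_frequently_mem_levelSet (hX : IsRothberger X)
    {e : List (Set X) → ℕ → Set X} (heo : ∀ s m, IsOpen (e s m))
    (he : ∀ s x, ∃ m, x ∈ e s m) :
    ∃ f : ℕ → ℕ, ∀ x N, ∃ n, N ≤ n ∧ x ∈ levelSet e f n := by
  classical
  have hsel (p : ℕ → ℕ) (N : ℕ) : ∃ t : ℕ → ℕ → ℕ, (∀ k, ∀ i < N, t k i = p i) ∧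
      ∀ x, ∃ k, ∀ i ≤ k, x ∈ levelSet e (t k) (N + i) := by
    -- Only `k + 1` levels are intersected, so that the sets stay open.
    let O : ℕ → Set (Set X) := fun k =>
      {W | ∃ h : ℕ → ℕ, (∀ i < N, h i = p i) ∧ W = ⋂ i ∈ Iic k, levelSet e h (N + i)}
    obtain ⟨T, hT, hTc⟩ := hX O fun k => by
      refine ⟨?_, eq_univ_of_forall fun x => ?_⟩
      · rintro _ ⟨h, -, rfl⟩
        exact (finite_Iic k).isOpen_biInter fun i _ => isOpen_levelSet heo h _
      · obtain ⟨h, hp, hx⟩ := exists_extension_mem_levelSet he p N x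
        exact ⟨_, ⟨h, hp, rfl⟩, mem_iInter₂.2 fun i _ => hx _ (Nat.le_add_right _ _)⟩
    choose t htp htT using hT
    refine ⟨t, htp, fun x => ?_⟩
    obtain ⟨_, ⟨k, rfl⟩, hk⟩ : x ∈ ⋃₀ range T := hTc.2 ▸ mem_univ x
    rw [htT] at hk
    exact ⟨k, fun i hi => mem_iInter₂.1 hk i hi⟩
  choose t htp ht using hsel
  let trunc : (ℕ → ℕ) → ℕ → ℕ → ℕ := fun h N i => if i < N then h i else 0
  -- Diagonal domination: for every prefix length `N`, the `k`-th selected bound is dominated at the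
  -- single level `N + k`.
  let Φ : ℕ → (ℕ → ℕ) → ℕ := fun n h =>
    (Finset.range (n + 1)).sup fun N => t (trunc h N) N (n - N) n
  let f := courseOfValues Φ
  have hf (N k : ℕ) : t (trunc f N) N k (N + k) ≤ f (N + k) := by
    have h1 : f (N + k) = Φ (N + k) fun i => if _h : i < N + k then f i else 0 := by
      simp only [f]; rw [courseOfValues]
    have h2 : trunc (fun i => if _h : i < N + k then f i else 0) N = trunc f N := by
      funext i
      simp only [trunc]
      split_ifs with h3 h4
      · rfl
      · omega
      · rfl
    rw [h1]
    have := Finset.le_sup (s := Finset.range (N + k + 1))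
      (f := fun M => t (trunc (fun i => if _h : i < N + k then f i else 0) M) M (N + k - M) (N + k))
      (b := N) (by simp)
    simp only [h2, Nat.add_sub_cancel_left] at this
    exact this
  refine ⟨f, fun x N => ?_⟩
  obtain ⟨k, hk⟩ := ht (trunc f N) N x
  have hex : ∃ i, i ≤ k ∧ t (trunc f N) N k (N + i) ≤ f (N + i) := ⟨k, le_rfl, hf N k⟩
  -- A larger bound also allows more positions, so level sets are not monotone. At the first level
  -- where `f` catches up with the selected bound, every position allowed by `f` is still allowed by
  -- that bound, while the answers allowed by `f` include its answers.
  let i := Nat.find hex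
  obtain ⟨hik, hi⟩ : i ≤ k ∧ t (trunc f N) N k (N + i) ≤ f (N + i) := Nat.find_spec hex
  refine ⟨N + i, Nat.le_add_right _ _, ?_⟩
  have hx := hk i hik
  simp only [levelSet, mem_iInter₂, mem_iUnion₂] at hx ⊢
  intro s hs
  have hs' : s ∈ reach e (t (trunc f N) N k) (N + i) := by
    refine reach_mono e (fun j hj => ?_) hs
    rcases lt_or_ge j N with hjN | hjN
    · rw [htp _ _ _ _ hjN]; simp [trunc, hjN]
    · obtain ⟨l, rfl⟩ := Nat.exists_eq_add_of_le hjN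
      have hl : l < i := by omega
      have := Nat.find_min hex hl
      by_contra hcon
      exact this ⟨hl.le.trans hik, by omega⟩
  obtain ⟨m, hm, hxm⟩ := hx s hs'
  exact ⟨m, le_trans hm hi, hxm⟩

/-- In a Rothberger space one can choose one answer to each bounded position so that each point is
covered, at some inning, by the answers to all the bounded positions of that inning. -/
theorem IsRothberger.exists_answers (hX : IsRothberger X)
    {e : List (Set X) → ℕ → Set X} (heo : ∀ s m, IsOpen (e s m)) {f : ℕ → ℕ}
    (hf : ∀ x N, ∃ n, N ≤ n ∧ x ∈ levelSet e f n) :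
    ∃ c : ℕ → List (Set X) → ℕ, (∀ n s, c n s ≤ f n) ∧
      ∀ x, ∃ n, ∀ s ∈ reach e f n, x ∈ e s (c n s) := by
  classical
  -- The `k`-th cover prescribes answers on `k + 1` levels, which leaves room to use distinct levels
  -- for distinct `k`.
  let O : ℕ → Set (Set X) := fun k =>
    {W | ∃ S : Finset ℕ, ∃ c : ℕ → List (Set X) → ℕ, S.card = k + 1 ∧ (∀ n s, c n s ≤ f n) ∧
      W = ⋂ n ∈ S, ⋂ s ∈ reach e f n, e s (c n s)}
  obtain ⟨T, hT, hTc⟩ := hX O fun k => by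
    refine ⟨?_, eq_univ_of_forall fun x => ?_⟩
    · rintro _ ⟨S, c, -, -, rfl⟩
      exact isOpen_biInter_finset fun n _ =>
        (finite_reach e f n).isOpen_biInter fun s _ => heo _ _
    · have hinf : {n | x ∈ levelSet e f n}.Infinite :=
        infinite_of_not_bddAbove fun ⟨N, hN⟩ => by
          obtain ⟨n, h1, h2⟩ := hf x (N + 1)
          exact absurd (hN h2) (by omega)
      obtain ⟨S, hS, hcard⟩ := hinf.exists_subset_card_eq (k + 1)
      have hc (n : ℕ) (s : List (Set X)) :
          ∃ m ≤ f n, n ∈ S → s ∈ reach e f n → x ∈ e s m := by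
        by_cases h : n ∈ S ∧ s ∈ reach e f n
        · have hx : x ∈ levelSet e f n := hS h.1
          obtain ⟨m, hm, hxm⟩ := mem_iUnion₂.1 (mem_iInter₂.1 hx s h.2)
          exact ⟨m, hm, fun _ _ => hxm⟩
        · exact ⟨0, Nat.zero_le _, fun h1 h2 => (h ⟨h1, h2⟩).elim⟩
      choose c hcf hxc using hc
      exact ⟨_, ⟨S, c, hcard, hcf, rfl⟩,
        mem_iInter₂.2 fun n hn => mem_iInter₂.2 fun s hs => hxc n s hn hs⟩
  choose S c hcard hcf hTS using hT
  -- Hall's theorem assigns to each `k` its own level `j k` in `S k`.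
  obtain ⟨j, hj, hjS⟩ := (Finset.all_card_le_biUnion_card_iff_exists_injective S).1 fun s => by
    rcases s.eq_empty_or_nonempty with rfl | hs
    · simp
    · have h1 : s ⊆ Finset.range (s.max' hs + 1) := fun a ha => by
        simpa [Nat.lt_succ_iff] using s.le_max' a ha
      calc s.card ≤ s.max' hs + 1 := by simpa using Finset.card_le_card h1
        _ = (S (s.max' hs)).card := (hcard _).symm
        _ ≤ _ := Finset.card_le_card (Finset.subset_biUnion_of_mem S (s.max'_mem hs))
  refine ⟨fun n => c (Function.invFun j n) n, fun n s => hcf _ _ _, fun x => ?_⟩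
  obtain ⟨_, ⟨k, rfl⟩, hk⟩ : x ∈ ⋃₀ range T := hTc.2 ▸ mem_univ x
  rw [hTS] at hk
  refine ⟨j k, fun s hs => ?_⟩
  simp only [Function.leftInverse_invFun hj k]
  exact mem_iInter₂.1 (mem_iInter₂.1 hk (j k) (hjS k)) s hs

/-- Pawlikowski's theorem. -/
theorem IsRothberger.not_oneHasWinningStrategy (hX : IsRothberger X) :
    ¬ OneHasWinningStrategy (openCovers X) (openCovers X) := by
  rintro ⟨F, hF⟩
  -- Selecting from a constant sequence enumerates a countable subcover of ONE's move.
  choose e heF hec using fun s => hX (fun _ => F.move s) fun _ => F.move_mem s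
  have heo (s m) : IsOpen (e s m) := (hec s).1 _ ⟨m, rfl⟩
  have he (s : List (Set X)) (x : X) : ∃ m, x ∈ e s m := by
    obtain ⟨_, ⟨m, rfl⟩, hm⟩ : x ∈ ⋃₀ range (e s) := (hec s).2 ▸ mem_univ x
    exact ⟨m, hm⟩
  obtain ⟨f, hf⟩ := hX.exists_frequently_mem_levelSet heo he
  obtain ⟨c, hcf, hc⟩ := hX.exists_answers heo hf
  let L : ℕ → List (Set X) := fun n => Nat.rec [] (fun n s => s ++ [e s (c n s)]) n
  let T : ℕ → Set X := fun n => e (L n) (c n (L n))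
  have hL (n) : L (n + 1) = L n ++ [T n] := rfl
  have hTL (n) : (List.ofFn fun i : Fin n => T i) = L n := by
    induction n with
    | zero => simp [L]
    | succ n ih =>
      rw [List.ofFn_succ_last, hL, ← ih]
      simp
  have hreach (n) : L n ∈ reach e f n := by
    induction n with
    | zero => exact rfl
    | succ n ih => exact mem_biUnion ih ⟨_, hcf n (L n), rfl⟩
  refine hF T (fun n => ?_) ⟨?_, eq_univ_of_forall fun x => ?_⟩
  · rw [hTL]
    exact heF _ _
  · rintro _ ⟨n, rfl⟩
    exact heo _ _
  · obtain ⟨n, hn⟩ := hc x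
    exact ⟨_, ⟨n, rfl⟩, hn _ (hreach n)⟩

end Game

end CoverRamsey

theorem mainTheorem10 (X : Type*) [TopologicalSpace X] [T2Space X] [RegularSpace X] [Nonempty X] :
    List.TFAE [
      CoverRamsey.IsRothberger X,
      ¬ CoverRamsey.OneHasWinningStrategy (CoverRamsey.openCovers X) (CoverRamsey.openCovers X),
      ∀ k : ℕ, 0 < k →
        CoverRamsey.Arrow (CoverRamsey.omegaCovers X) (CoverRamsey.openCovers X) 2 k] := by
  tfae_have 1 → 2 := fun h => h.not_oneHasWinningStrategy
  tfae_have 2 → 3 := fun h k hk => CoverRamsey.arrow_of_not_oneHasWinningStrategy h hk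
  tfae_have 3 → 1 := fun h => by
    -- A finite space has no `ω`-cover, so the partition relation says nothing there.
    cases finite_or_infinite X
    · exact CoverRamsey.isRothberger_of_finite
    · exact CoverRamsey.isRothberger_of_selectOne_omegaCovers
        (CoverRamsey.selectOne_omegaCovers_of_arrow (h 2 two_pos))
  tfae_finish
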